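/- Let $n\ge 1$, let $\omega=\sum_{i=1}^n dx_i\wedge dy_i$ be the standard symplectic form on $\mathbb R^{2n}$, let $\mathrm{Sp}(2n)$ be the group of real $2n\times 2n$ matrices preserving $\omega$, and let $\mathfrak{sp}(2n)$ be the set of real $2n\times 2n$ matrices $X$ such that the bilinear form $\omega(\cdot,X\cdot)$ is symmetric. Let $$C(\mathrm{id})=\{X\in\mathfrak{sp}(2n)\setminus\{0\} : \omega(\cdot,X\cdot)\text{ is positive semidefinite}\},\qquad C(W)=W\,C(\mathrm{id})=C(\mathrm{id})\,W\subset T_W\mathrm{Sp}(2n)\quad (W\in\mathrm{Sp}(2n)).$$ Extend $\omega$ to $\mathbb C^{2n}$ as a form which is complex linear in the first argument and antilinear in the second, and let $\kappa=-i\omega$ be the (Hermitian) Krein form. Let $M=\mathrm{Sp}_{\mathrm{ell}}^+(2n)$, the positively elliptic region, be the set of all $W\in\mathrm{Sp}(2n)$ such that every complex eigenvalue $\lambda$ of $W$ satisfies $|\lambda|=1$ and $\lambda\neq\pm1$, and $\kappa$ is positive definite on the generalised eigenspace of the eigenvalue $\lambda$ if and only if $\operatorname{Im}\lambda>0$. A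 causal curve in $M$ is a smooth curve $\gamma\colon[a,b]\to M$, $a<b$, with $\gamma'(t)\in C(\gamma(t))$ for all $t\in[a,b]$. For $W\in M$ let $J^+(W)$ (respectively $J^-(W)$) be the set consisting of $W$ and of all $V\in M$ for which there is a causal curve in $M$ from $W$ to $V$ (respectively from $V$ to $W$). Then $M$ with the cone structure $C|_M$ is globally hyperbolic: there is no causal curve $\gamma\colon[a,b]\to M$ with $\gamma(a)=\gamma(b)$, and for all $W_0,W_1\in M$ the causal diamond $J^+(W_0)\cap J^-(W_1)$ is compact. -/

import Mathlib

open Set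
open scoped ContDiff

-- The space of matrices is finite dimensional, so the choice of a norm is immaterial.
open scoped Matrix.Norms.Operator

/-! Causality theory of a cone field `C` on a subset `M` of a normed space `E`; here `M` is
meant to be an embedded submanifold and `C p` a cone of nonzero vectors tangent to `M` at `p`. -/

section Causality

variable {E : Type*} [NormedAddCommGroup E] [NormedSpace ℝ E]

/-- `γ`, restricted to `[a, b]`, is a causal curve of `(M, C)`: a smooth curve in `M` whose
velocity at every time lies in the cone. -/
structure IsCausalCurve (M : Set E) (C : E → Set E) (γ : ℝ → E) (a b : ℝ) : Prop where
  lt : a < b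
  smooth : ContDiffOn ℝ ∞ γ (Icc a b)
  mem : ∀ t ∈ Icc a b, γ t ∈ M
  velocity_mem : ∀ t ∈ Icc a b, derivWithin γ (Icc a b) t ∈ C (γ t)

/-- There is a causal curve of `(M, C)` from `p` to `q`. -/
def CausallyJoined (M : Set E) (C : E → Set E) (p q : E) : Prop :=
  ∃ (γ : ℝ → E) (a b : ℝ), IsCausalCurve M C γ a b ∧ γ a = p ∧ γ b = q

/-- The causal future of `p` in `(M, C)`. -/
def causalFuture (M : Set E) (C : E → Set E) (p : E) : Set E :=
  {q | CausallyJoined M C p q} ∪ {p}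

/-- The causal past of `p` in `(M, C)`. -/
def causalPast (M : Set E) (C : E → Set E) (p : E) : Set E :=
  {q | CausallyJoined M C q p} ∪ {p}

/-- `(M, C)` is globally hyperbolic: it has no closed causal curves, and all its causal diamonds
are compact. -/
structure IsGloballyHyperbolic (M : Set E) (C : E → Set E) : Prop where
  causal : ∀ (γ : ℝ → E) (a b : ℝ), IsCausalCurve M C γ a b → γ a ≠ γ b
  compact_diamond : ∀ p ∈ M, ∀ q ∈ M, IsCompact (causalFuture M C p ∩ causalPast M C q)

end Causality

/-- The standard symplectic form `∑ dxᵢ ∧ dyᵢ`, the coordinates being `xᵢ = u (Sum.inl i)` and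
`yᵢ = u (Sum.inr i)`, over any commutative ring. -/
def symplecticForm {R : Type*} [CommRing R] {n : ℕ} (u v : Fin n ⊕ Fin n → R) : R :=
  ∑ i, (u (Sum.inl i) * v (Sum.inr i) - u (Sum.inr i) * v (Sum.inl i))

/-- The cone at the identity: the nonzero matrices `X` such that the bilinear form `ω(·, X ·)` is
symmetric (that is, `X ∈ 𝔰𝔭(2n)`) and positive semidefinite. -/
def symplecticConeAtId (n : ℕ) : Set (Matrix (Fin n ⊕ Fin n) (Fin n ⊕ Fin n) ℝ) :=
  {X | X ≠ 0 ∧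
    (∀ u v, symplecticForm u (X.mulVec v) = symplecticForm v (X.mulVec u)) ∧
    ∀ u, 0 ≤ symplecticForm u (X.mulVec u)}

/-- The left translate `C(W) = W C(id)` of the cone at the identity. -/
def symplecticCone (n : ℕ) (W : Matrix (Fin n ⊕ Fin n) (Fin n ⊕ Fin n) ℝ) :
    Set (Matrix (Fin n ⊕ Fin n) (Fin n ⊕ Fin n) ℝ) :=
  (fun X => W * X) '' symplecticConeAtId n

/-- The Krein form `κ(v, w) = -i ω(v, w̄)` on `ℂ²ⁿ`. -/
noncomputable def kreinForm {n : ℕ} (v w : Fin n ⊕ Fin n → ℂ) : ℂ :=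
  -Complex.I * symplecticForm v (star w)

/-- A real matrix, viewed as a linear endomorphism of `ℂ²ⁿ`. -/
noncomputable def complexEnd {n : ℕ} (W : Matrix (Fin n ⊕ Fin n) (Fin n ⊕ Fin n) ℝ) :
    Module.End ℂ (Fin n ⊕ Fin n → ℂ) :=
  Matrix.toLin' (W.map (algebraMap ℝ ℂ))

/-- The Krein form is positive definite on the subspace `F` (its diagonal values are real). -/
def KreinPositiveOn {n : ℕ} (F : Submodule ℂ (Fin n ⊕ Fin n → ℂ)) : Prop :=
  ∀ v ∈ F, v ≠ 0 → 0 < (kreinForm v v).re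

/-- The positively elliptic region of `Sp(2n)`: all complex eigenvalues lie on the unit circle and
differ from `±1`, and the Krein form is positive definite on the generalised eigenspace of an
eigenvalue precisely when that eigenvalue has positive imaginary part. -/
def positivelyEllipticRegion (n : ℕ) : Set (Matrix (Fin n ⊕ Fin n) (Fin n ⊕ Fin n) ℝ) :=
  {W | W ∈ Matrix.symplecticGroup (Fin n) ℝ ∧
    ∀ z : ℂ, (complexEnd W).HasEigenvalue z →
      ‖z‖ = 1 ∧ z ≠ 1 ∧ z ≠ -1 ∧
      (KreinPositiveOn ((complexEnd W).maxGenEigenspace z) ↔ 0 < z.im)}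

/-!
Consider `Im κ(W v, v)`. For real `v` this is `ω(v, W v)`, and for an eigenvector `v` with
eigenvalue `z` it is `Im z * κ(v, v)`. Since the eigenspaces of an elliptic `W` are
`κ`-orthogonal, and semisimple as soon as `κ` is definite on them, the positively elliptic region is
the set of symplectic matrices `W` such that `ω(x, W x) > 0` for all `x ≠ 0`
(`positivelyEllipticRegion_eq_positiveSymplectic`).

Such a `W` does not have the eigenvalue `1`, so the Cayley transform `B = (W - 1)⁻¹` is defined. It
identifies the region with the matrices `B`, `B + ½ ∈ 𝔰𝔭(2n)`, whose quadratic form `ω(u, B u)` is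
negative definite. This is a convex set, and in this chart the cone structure is flat: a velocity
`W X` becomes `B' = -B W X B`, and `ω(u, B' v) = ω(B u, X B v)`, so that the cone consists of the
nonzero positive semidefinite forms at every point. Hence the form `ω(u, B u)` is monotone along a
causal curve, and not constant, so no causal curve closes up. Conversely the segment between two
comparable forms is causal. A causal diamond is therefore the image of an order interval
`{B | B₀ ≤ B ≤ B₁}` of negative definite forms (`causalDiamond_eq_image`), which is closed and, by
polarization, bounded; the inverse of the chart is continuous on it.
-/

/-! ### The symplectic form -/

section SymplecticForm

variable {R : Type*} [CommRing R] {n : ℕ}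

theorem symplecticForm_add_left (u v w : Fin n ⊕ Fin n → R) :
    symplecticForm (u + v) w = symplecticForm u w + symplecticForm v w := by
  simp only [symplecticForm, Pi.add_apply, ← Finset.sum_add_distrib]
  exact Finset.sum_congr rfl fun i _ => by ring

theorem symplecticForm_smul_left (c : R) (u v : Fin n ⊕ Fin n → R) :
    symplecticForm (c • u) v = c * symplecticForm u v := by
  simp only [symplecticForm, Pi.smul_apply, smul_eq_mul, Finset.mul_sum]
  exact Finset.sum_congr rfl fun i _ => by ring

theorem symplecticForm_antisymm (u v : Fin n ⊕ Fin n → R) :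
    symplecticForm u v = -symplecticForm v u := by
  simp only [symplecticForm, ← Finset.sum_neg_distrib]
  exact Finset.sum_congr rfl fun i _ => by ring

theorem symplecticForm_self (u : Fin n ⊕ Fin n → R) : symplecticForm u u = 0 :=
  Finset.sum_eq_zero fun i _ => by ring

theorem symplecticForm_add_right (u v w : Fin n ⊕ Fin n → R) :
    symplecticForm u (v + w) = symplecticForm u v + symplecticForm u w := by
  rw [symplecticForm_antisymm, symplecticForm_add_left, symplecticForm_antisymm v,
    symplecticForm_antisymm w]
  ring

theorem symplecticForm_smul_right (c : R) (u v : Fin n ⊕ Fin n → R) :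
    symplecticForm u (c • v) = c * symplecticForm u v := by
  rw [symplecticForm_antisymm, symplecticForm_smul_left, symplecticForm_antisymm v]
  ring

theorem symplecticForm_neg_right (u v : Fin n ⊕ Fin n → R) :
    symplecticForm u (-v) = -symplecticForm u v := by
  simpa using symplecticForm_smul_right (-1) u v

theorem symplecticForm_zero_left (v : Fin n ⊕ Fin n → R) : symplecticForm 0 v = 0 := by
  simp [symplecticForm]

theorem symplecticForm_zero_right (v : Fin n ⊕ Fin n → R) : symplecticForm v 0 = 0 := by
  simp [symplecticForm]

theorem symplecticForm_sub_left (u v w : Fin n ⊕ Fin n → R) :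
    symplecticForm (u - v) w = symplecticForm u w - symplecticForm v w := by
  have := symplecticForm_add_left (u - v) v w
  rw [sub_add_cancel] at this
  rw [this]; ring

theorem symplecticForm_sub_right (u v w : Fin n ⊕ Fin n → R) :
    symplecticForm u (v - w) = symplecticForm u v - symplecticForm u w := by
  have := symplecticForm_add_right u (v - w) w
  rw [sub_add_cancel] at this
  rw [this]; ring

theorem symplecticForm_single_inl (i : Fin n) (v : Fin n ⊕ Fin n → R) :
    symplecticForm (Pi.single (Sum.inl i) 1) v = v (Sum.inr i) := by
  simp [symplecticForm, Pi.single_apply]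

theorem symplecticForm_single_inr (i : Fin n) (v : Fin n ⊕ Fin n → R) :
    symplecticForm (Pi.single (Sum.inr i) 1) v = -v (Sum.inl i) := by
  simp [symplecticForm, Pi.single_apply]

/-- The symplectic form is nondegenerate. -/
theorem eq_of_forall_symplecticForm_eq {v w : Fin n ⊕ Fin n → R}
    (h : ∀ u, symplecticForm u v = symplecticForm u w) : v = w := by
  funext k
  rcases k with i | i
  · simpa [symplecticForm_single_inr] using h (Pi.single (Sum.inr i) 1)
  · simpa [symplecticForm_single_inl] using h (Pi.single (Sum.inl i) 1)

theorem matrix_eq_of_forall_symplecticForm_eq {A B : Matrix (Fin n ⊕ Fin n) (Fin n ⊕ Fin n) R}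
    (h : ∀ u v, symplecticForm u (A.mulVec v) = symplecticForm u (B.mulVec v)) : A = B :=
  Matrix.ext_of_mulVec_single fun _ => eq_of_forall_symplecticForm_eq fun _ => h _ _

/-- Mathlib's matrix `J` has the opposite sign. -/
theorem symplecticForm_eq_neg_dotProduct (u v : Fin n ⊕ Fin n → R) :
    symplecticForm u v = -(u ⬝ᵥ (Matrix.J (Fin n) R).mulVec v) := by
  simp [symplecticForm, Matrix.J, Matrix.fromBlocks_mulVec, dotProduct,
    Matrix.neg_mulVec, Finset.sum_sub_distrib]
  ring

theorem mem_symplecticGroup_iff_symplecticForm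
    {A : Matrix (Fin n ⊕ Fin n) (Fin n ⊕ Fin n) R} :
    A ∈ Matrix.symplecticGroup (Fin n) R ↔
      ∀ u v, symplecticForm (A.mulVec u) (A.mulVec v) = symplecticForm u v := by
  have key (u v : Fin n ⊕ Fin n → R) : symplecticForm (A.mulVec u) (A.mulVec v) =
      -(u ⬝ᵥ (A.transpose * Matrix.J (Fin n) R * A).mulVec v) := by
    rw [symplecticForm_eq_neg_dotProduct, mul_assoc, ← Matrix.mulVec_mulVec,
      ← Matrix.mulVec_mulVec, Matrix.dotProduct_mulVec u, Matrix.vecMul_transpose]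
  rw [← SymplecticGroup.transpose_mem_iff, SymplecticGroup.mem_iff, Matrix.transpose_transpose]
  constructor
  · intro h u v
    rw [key, h, symplecticForm_eq_neg_dotProduct]
  · intro h
    refine Matrix.ext_of_mulVec_single fun j => ?_
    refine dotProduct_eq _ _ fun u => ?_
    have := h u (Pi.single j 1)
    rw [key, symplecticForm_eq_neg_dotProduct, neg_inj] at this
    rw [dotProduct_comm, this, dotProduct_comm]

end SymplecticForm

/-! ### The Krein form and the positively elliptic region -/

section Krein

variable {n : ℕ}

theorem kreinForm_add_left (u v w : Fin n ⊕ Fin n → ℂ) :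
    kreinForm (u + v) w = kreinForm u w + kreinForm v w := by
  simp only [kreinForm, symplecticForm_add_left]; ring

theorem kreinForm_smul_left (c : ℂ) (u v : Fin n ⊕ Fin n → ℂ) :
    kreinForm (c • u) v = c * kreinForm u v := by
  simp only [kreinForm, symplecticForm_smul_left]; ring

theorem star_symplecticForm (u v : Fin n ⊕ Fin n → ℂ) :
    star (symplecticForm u v) = symplecticForm (star u) (star v) := by
  simp [symplecticForm]

theorem star_kreinForm (u v : Fin n ⊕ Fin n → ℂ) : star (kreinForm u v) = kreinForm v u := by
  rw [kreinForm, star_mul', star_symplecticForm, star_star, symplecticForm_antisymm, kreinForm]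
  simp

theorem kreinForm_add_right (u v w : Fin n ⊕ Fin n → ℂ) :
    kreinForm u (v + w) = kreinForm u v + kreinForm u w := by
  simp only [kreinForm, star_add, symplecticForm_add_right]; ring

theorem kreinForm_smul_right (c : ℂ) (u v : Fin n ⊕ Fin n → ℂ) :
    kreinForm u (c • v) = star c * kreinForm u v := by
  simp only [kreinForm, star_smul, symplecticForm_smul_right]; ring

theorem kreinForm_sum_left {ι : Type*} (s : Finset ι) (f : ι → Fin n ⊕ Fin n → ℂ)
    (w : Fin n ⊕ Fin n → ℂ) : kreinForm (∑ i ∈ s, f i) w = ∑ i ∈ s, kreinForm (f i) w :=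
  map_sum (AddMonoidHom.mk' (fun v => kreinForm v w) fun u v => kreinForm_add_left u v w) f s

theorem kreinForm_sum_right {ι : Type*} (s : Finset ι) (f : ι → Fin n ⊕ Fin n → ℂ)
    (w : Fin n ⊕ Fin n → ℂ) : kreinForm w (∑ i ∈ s, f i) = ∑ i ∈ s, kreinForm w (f i) :=
  map_sum (AddMonoidHom.mk' (kreinForm w) (kreinForm_add_right w)) f s

theorem kreinForm_self_im (v : Fin n ⊕ Fin n → ℂ) : (kreinForm v v).im = 0 :=
  Complex.conj_eq_iff_im.1 (star_kreinForm v v)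

theorem kreinForm_star_self (v : Fin n ⊕ Fin n → ℂ) :
    kreinForm (star v) (star v) = -kreinForm v v := by
  rw [kreinForm, star_star, symplecticForm_antisymm, kreinForm]; ring

theorem complexEnd_apply (W : Matrix (Fin n ⊕ Fin n) (Fin n ⊕ Fin n) ℝ)
    (v : Fin n ⊕ Fin n → ℂ) : complexEnd W v = (W.map (algebraMap ℝ ℂ)).mulVec v :=
  rfl

theorem complexEnd_star (W : Matrix (Fin n ⊕ Fin n) (Fin n ⊕ Fin n) ℝ)
    (v : Fin n ⊕ Fin n → ℂ) : complexEnd W (star v) = star (complexEnd W v) := by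
  funext k
  simp [complexEnd_apply, Matrix.mulVec, dotProduct]

theorem kreinForm_complexEnd {W : Matrix (Fin n ⊕ Fin n) (Fin n ⊕ Fin n) ℝ}
    (hW : W ∈ Matrix.symplecticGroup (Fin n) ℝ) (u v : Fin n ⊕ Fin n → ℂ) :
    kreinForm (complexEnd W u) (complexEnd W v) = kreinForm u v := by
  have hC : W.map (algebraMap ℝ ℂ) ∈ Matrix.symplecticGroup (Fin n) ℂ := by
    have h := congrArg (fun A => A.map (algebraMap ℝ ℂ)) (SymplecticGroup.mem_iff.1 hW)
    rw [SymplecticGroup.mem_iff]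
    simp only [Matrix.map_mul, Matrix.J] at h ⊢
    simpa [Matrix.fromBlocks_map, Matrix.transpose_map, Matrix.map_neg] using h
  rw [kreinForm, ← complexEnd_star, complexEnd_apply, complexEnd_apply,
    mem_symplecticGroup_iff_symplecticForm.1 hC, kreinForm]

/-- The imaginary part of `κ(W v, v)` is the sum of the values of the real quadratic form
`x ↦ ω(x, W x)` at the real and imaginary parts of `v`. -/
theorem im_kreinForm_complexEnd_self (W : Matrix (Fin n ⊕ Fin n) (Fin n ⊕ Fin n) ℝ)
    (v : Fin n ⊕ Fin n → ℂ) :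
    (kreinForm (complexEnd W v) v).im =
      symplecticForm (fun i => (v i).re) (W.mulVec fun i => (v i).re) +
      symplecticForm (fun i => (v i).im) (W.mulVec fun i => (v i).im) := by
  have hre (k) : (complexEnd W v k).re = W.mulVec (fun i => (v i).re) k := by
    simp [complexEnd_apply, Matrix.mulVec, dotProduct]
  have him (k) : (complexEnd W v k).im = W.mulVec (fun i => (v i).im) k := by
    simp [complexEnd_apply, Matrix.mulVec, dotProduct]
  simp only [kreinForm, symplecticForm, ← Finset.sum_add_distrib, Complex.mul_im, Complex.neg_im,
    Complex.I_re, Complex.I_im, Complex.re_sum, Complex.sub_re, Complex.mul_re,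
    Pi.star_apply, Complex.star_def, Complex.conj_re, Complex.conj_im, hre, him,
    zero_mul, zero_add, neg_mul, one_mul, ← Finset.sum_neg_distrib]
  exact Finset.sum_congr rfl fun i _ => by ring

/-- If the Krein form does not vanish on the eigenvectors of `W` for a number `z` on the unit
circle, then `z` is semisimple: a vector of the form `(W - z) w` which is killed by `W - z` is
isotropic, since `W` preserves the Krein form. -/
theorem maxGenEigenspace_eq_eigenspace {W : Matrix (Fin n ⊕ Fin n) (Fin n ⊕ Fin n) ℝ}
    (hW : W ∈ Matrix.symplecticGroup (Fin n) ℝ) {z : ℂ} (hz : ‖z‖ = 1)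
    (h : ∀ v, complexEnd W v = z • v → v ≠ 0 → kreinForm v v ≠ 0) :
    (complexEnd W).maxGenEigenspace z = (complexEnd W).eigenspace z := by
  refine le_antisymm (fun w hw => ?_) ((complexEnd W).genEigenspace z |>.mono le_top)
  have hzz : z * star z = 1 := by
    rw [Complex.star_def, Complex.mul_conj, Complex.normSq_eq_norm_sq, hz]; simp
  obtain ⟨k, hk⟩ := Module.End.mem_maxGenEigenspace _ _ _ |>.1 hw
  set N := complexEnd W - z • (1 : Module.End ℂ (Fin n ⊕ Fin n → ℂ)) with hN
  have hNapply (v) : N v = complexEnd W v - z • v := rfl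
  have two_step (w) (hw : N (N w) = 0) : N w = 0 := by
    by_contra hne
    set v := N w with hv
    have hWv : complexEnd W v = z • v := by rwa [hNapply, sub_eq_zero] at hw
    have hWw : complexEnd W w = v + z • w := by rw [hv, hNapply]; abel
    have h1 := kreinForm_complexEnd hW v w
    rw [hWv, hWw, kreinForm_add_right, kreinForm_smul_left, kreinForm_smul_left,
      kreinForm_smul_right, ← mul_assoc, hzz, one_mul, add_eq_right, mul_eq_zero] at h1
    rcases h1 with h1 | h1
    · simp [h1] at hz
    · exact h v hWv hne h1
  have all (k : ℕ) : ∀ w, (N ^ (k + 1)) w = 0 → N w = 0 := by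
    induction k with
    | zero => intro w hw; simpa using hw
    | succ k ih =>
      intro w hw
      rw [pow_succ, Module.End.mul_apply] at hw
      exact two_step w (ih _ hw)
  rw [Module.End.mem_eigenspace_iff, ← sub_eq_zero, ← hNapply]
  refine all k w ?_
  rw [pow_succ', Module.End.mul_apply, hk, map_zero]

/-- The symplectic matrices `W` whose quadratic form `x ↦ ω(x, W x)` is positive definite. -/
def positiveSymplectic (n : ℕ) : Set (Matrix (Fin n ⊕ Fin n) (Fin n ⊕ Fin n) ℝ) :=
  {W | (∀ u v, symplecticForm (W.mulVec u) (W.mulVec v) = symplecticForm u v) ∧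
    ∀ x, x ≠ 0 → 0 < symplecticForm x (W.mulVec x)}

theorem im_ne_zero_of_norm_eq_one {z : ℂ} (h : ‖z‖ = 1) (h1 : z ≠ 1) (h2 : z ≠ -1) :
    z.im ≠ 0 := by
  intro him
  have hs : z.re * z.re = 1 := by
    have := Complex.normSq_apply z
    rw [Complex.normSq_eq_norm_sq, h, him] at this
    linarith
  rcases mul_self_eq_one_iff.1 hs with h | h
  · exact h1 (Complex.ext (by simp [h]) (by simp [him]))
  · exact h2 (Complex.ext (by simp [h]) (by simp [him]))

/-- On an eigenvector `v` of `W` for `z`, positivity of `x ↦ ω(x, W x)` says that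
`Im κ(W v, v) = Im z * κ(v, v)` is positive, from which all spectral conditions follow. -/
theorem positiveSymplectic_subset_positivelyEllipticRegion :
    positiveSymplectic n ⊆ positivelyEllipticRegion n := by
  rintro W ⟨hsp, hpos⟩
  have hW : W ∈ Matrix.symplecticGroup (Fin n) ℝ := mem_symplecticGroup_iff_symplecticForm.2 hsp
  refine ⟨hW, fun z hz => ?_⟩
  have sign (v) (hv : complexEnd W v = z • v) (hne : v ≠ 0) : 0 < z.im * (kreinForm v v).re := by
    have h1 := im_kreinForm_complexEnd_self W v
    rw [hv, kreinForm_smul_left, Complex.mul_im, kreinForm_self_im, mul_zero, zero_add] at h1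
    rw [h1]
    have nonneg (x) : 0 ≤ symplecticForm x (W.mulVec x) := by
      rcases eq_or_ne x 0 with rfl | hx
      · simp [symplecticForm_zero_left]
      · exact (hpos x hx).le
    by_cases hre : (fun i => (v i).re) = 0
    · have him : (fun i => (v i).im) ≠ 0 := fun him =>
        hne (funext fun i => Complex.ext (congrFun hre i) (congrFun him i))
      exact add_pos_of_nonneg_of_pos (nonneg _) (hpos _ him)
    · exact add_pos_of_pos_of_nonneg (hpos _ hre) (nonneg _)
  obtain ⟨v, hv⟩ := hz.exists_hasEigenvector
  have hvz := hv.apply_eq_smul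
  have hs := sign v hvz hv.2
  have him : z.im ≠ 0 := left_ne_zero_of_mul hs.ne'
  have hnorm : ‖z‖ = 1 := by
    have h1 := kreinForm_complexEnd hW v v
    have hk : kreinForm v v ≠ 0 := fun h => by simp [h] at hs
    rw [hvz, kreinForm_smul_left, kreinForm_smul_right, ← mul_assoc, mul_eq_right₀ hk,
      Complex.star_def, Complex.mul_conj, Complex.normSq_eq_norm_sq] at h1
    have h2 : ‖z‖ ^ 2 = 1 := by exact_mod_cast h1
    exact (pow_eq_one_iff_of_nonneg (norm_nonneg z) two_ne_zero).1 h2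
  refine ⟨hnorm, ?_, ?_, ?_⟩
  · rintro rfl; simp at him
  · rintro rfl; simp at him
  rw [maxGenEigenspace_eq_eigenspace hW hnorm fun v hv hne h => by
    have := sign v hv hne
    simp [h] at this]
  constructor
  · intro h
    exact (pos_iff_pos_of_mul_pos hs).2 (h v hv.1 hv.2)
  · intro h v hv hne
    exact (pos_iff_pos_of_mul_pos (sign v (Module.End.mem_eigenspace_iff.1 hv) hne)).1 h

/-- For `W` positively elliptic, `ℂ²ⁿ` is the `κ`-orthogonal sum of the eigenspaces of `W`, and
`Im κ(W v, v) = ∑ Im z * κ(v_z, v_z)` is a sum of positive terms. -/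
theorem positivelyEllipticRegion_subset_positiveSymplectic :
    positivelyEllipticRegion n ⊆ positiveSymplectic n := by
  rintro W ⟨hW, hspec⟩
  refine ⟨mem_symplecticGroup_iff_symplecticForm.1 hW, fun x hx => ?_⟩
  have hval (z v) (hv : complexEnd W v = z • v) (hne : v ≠ 0) :
      (complexEnd W).HasEigenvalue z :=
    Module.End.hasEigenvalue_of_hasEigenvector
      ⟨Module.End.mem_eigenspace_iff.2 hv, hne⟩
  have sign (z : ℂ) (v) (hv : complexEnd W v = z • v) (hne : v ≠ 0) :
      0 < z.im * (kreinForm v v).re := by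
    obtain ⟨hn, h1, h2, hk⟩ := hspec z (hval z v hv hne)
    have memGen {z v} (hv : complexEnd W v = z • v) : v ∈ (complexEnd W).maxGenEigenspace z :=
      (complexEnd W).genEigenspace z |>.mono le_top (Module.End.mem_eigenspace_iff.2 hv)
    rcases lt_or_gt_of_ne (im_ne_zero_of_norm_eq_one hn h1 h2) with him | him
    · -- complex conjugation reduces this case to the eigenvalue `star z` of positive imaginary part
      have hv' : complexEnd W (star v) = star z • star v := by
        rw [complexEnd_star, hv, star_smul]
      have hne' : star v ≠ 0 := star_ne_zero.2 hne
      have := (hspec _ (hval _ _ hv' hne')).2.2.2.2 (by simpa using him) _ (memGen hv') hne'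
      rw [kreinForm_star_self, Complex.neg_re, neg_pos] at this
      exact mul_pos_of_neg_of_neg him this
    · exact mul_pos him (hk.2 him v (memGen hv) hne)
  have htop : ⨆ z, (complexEnd W).eigenspace z = ⊤ := by
    rw [← Module.End.iSup_maxGenEigenspace_eq_top (complexEnd W)]
    refine iSup_congr fun z => ?_
    by_cases hz : (complexEnd W).HasEigenvalue z
    · refine (maxGenEigenspace_eq_eigenspace hW (hspec z hz).1 fun v hv hne h => ?_).symm
      have := sign z v hv hne
      simp [h] at this
    · have h0 : (complexEnd W).eigenspace z = ⊥ := by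
        simpa [Module.End.hasEigenvalue_iff] using hz
      rw [h0]
      by_contra hne
      exact hz (Module.End.HasUnifEigenvalue.lt (k := ⊤) zero_lt_one (Ne.symm hne))
  have horth {z w : ℂ} {u v} (hu : complexEnd W u = z • u) (hv : complexEnd W v = w • v)
      (hzw : z ≠ w) : kreinForm u v = 0 := by
    by_contra hne
    have hv0 : v ≠ 0 := by rintro rfl; simp [kreinForm, symplecticForm_zero_right] at hne
    have h1 := kreinForm_complexEnd hW u v
    have hw : w * star w = 1 := by
      rw [Complex.star_def, Complex.mul_conj, Complex.normSq_eq_norm_sq,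
        (hspec w (hval w v hv hv0)).1]
      simp
    rw [hu, hv, kreinForm_smul_left, kreinForm_smul_right, ← mul_assoc, mul_eq_right₀ hne] at h1
    exact hzw (mul_right_cancel₀ (right_ne_zero_of_mul_eq_one hw) (h1.trans hw.symm))
  set xC : Fin n ⊕ Fin n → ℂ := fun i => (x i : ℂ) with hxC
  obtain ⟨f, hf, hsum⟩ := (Submodule.mem_iSup_iff_exists_finsupp _ xC).1
    (htop ▸ Submodule.mem_top : xC ∈ ⨆ z, (complexEnd W).eigenspace z)
  have hf' (z) : complexEnd W (f z) = z • f z := Module.End.mem_eigenspace_iff.1 (hf z)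
  have hK := im_kreinForm_complexEnd_self W xC
  simp only [hxC, Complex.ofReal_re, Complex.ofReal_im] at hK
  rw [show (fun _ => (0 : ℝ)) = (0 : Fin n ⊕ Fin n → ℝ) from rfl, symplecticForm_zero_left,
    add_zero, ← hxC, ← hsum, Finsupp.sum, map_sum, kreinForm_sum_left] at hK
  rw [← hK, Complex.im_sum]
  refine Finset.sum_pos (fun z hz => ?_) ?_
  · rw [kreinForm_sum_right, Finset.sum_eq_single z, hf' z, kreinForm_smul_left, Complex.mul_im,
      kreinForm_self_im, mul_zero, zero_add]
    · exact sign z (f z) (hf' z) (Finsupp.mem_support_iff.1 hz)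
    · intro w _ hwz
      rw [hf' z, kreinForm_smul_left, horth (hf' z) (hf' w) hwz.symm, mul_zero]
    · exact fun h => absurd hz h
  · rw [Finset.nonempty_iff_ne_empty, Ne, Finsupp.support_eq_empty]
    rintro rfl
    refine hx (funext fun i => ?_)
    have := congrFun hsum i
    simpa [hxC] using this.symm

theorem positivelyEllipticRegion_eq_positiveSymplectic :
    positivelyEllipticRegion n = positiveSymplectic n :=
  positivelyEllipticRegion_subset_positiveSymplectic.antisymm
    positiveSymplectic_subset_positivelyEllipticRegion

end Krein

/-! ### The Cayley chart -/

section Cayley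

variable {n : ℕ}

/-- A form of the Cayley transform, defined for the matrices without eigenvalue `1`. It differs
from `½ (W + 1) (W - 1)⁻¹` by the constant `½`. -/
noncomputable def cayley (W : Matrix (Fin n ⊕ Fin n) (Fin n ⊕ Fin n) ℝ) :
    Matrix (Fin n ⊕ Fin n) (Fin n ⊕ Fin n) ℝ :=
  (W - 1)⁻¹

/-- The inverse of `cayley`. -/
noncomputable def cayleyInv (B : Matrix (Fin n ⊕ Fin n) (Fin n ⊕ Fin n) ℝ) :
    Matrix (Fin n ⊕ Fin n) (Fin n ⊕ Fin n) ℝ :=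
  1 + B⁻¹

/-- The matrices `B` with `B + ½ ∈ 𝔰𝔭(2n)`; this is a linear space translated by `-½`. -/
def shiftedSp (n : ℕ) : Set (Matrix (Fin n ⊕ Fin n) (Fin n ⊕ Fin n) ℝ) :=
  {B | ∀ u v, symplecticForm (B.mulVec u) v + symplecticForm u (B.mulVec v) +
    symplecticForm u v = 0}

/-- The convex set of the `B` with `B + ½ ∈ 𝔰𝔭(2n)` whose quadratic form `u ↦ ω(u, B u)` is
negative definite. -/
def negativeShiftedSp (n : ℕ) : Set (Matrix (Fin n ⊕ Fin n) (Fin n ⊕ Fin n) ℝ) :=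
  {B | B ∈ shiftedSp n ∧ ∀ u, u ≠ 0 → symplecticForm u (B.mulVec u) < 0}

theorem isUnit_of_forall_mulVec_eq_zero {A : Matrix (Fin n ⊕ Fin n) (Fin n ⊕ Fin n) ℝ}
    (h : ∀ x, A.mulVec x = 0 → x = 0) : IsUnit A :=
  Matrix.mulVec_injective_iff_isUnit.1 <|
    (injective_iff_map_eq_zero (Matrix.mulVecLin A)).2 h

variable {W B D X : Matrix (Fin n ⊕ Fin n) (Fin n ⊕ Fin n) ℝ}

theorem isUnit_sub_one (hW : W ∈ positiveSymplectic n) : IsUnit (W - 1) := by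
  refine isUnit_of_forall_mulVec_eq_zero fun x hx => ?_
  rw [Matrix.sub_mulVec, Matrix.one_mulVec, sub_eq_zero] at hx
  by_contra hne
  have := hW.2 x hne
  rw [hx, symplecticForm_self] at this
  exact this.false

theorem isUnit_of_mem_positiveSymplectic (hW : W ∈ positiveSymplectic n) : IsUnit W := by
  refine isUnit_of_forall_mulVec_eq_zero fun x hx => ?_
  by_contra hne
  have := hW.2 x hne
  rw [hx, symplecticForm_zero_right] at this
  exact this.false

theorem isUnit_of_mem_negativeShiftedSp (hB : B ∈ negativeShiftedSp n) : IsUnit B := by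
  refine isUnit_of_forall_mulVec_eq_zero fun x hx => ?_
  by_contra hne
  have := hB.2 x hne
  rw [hx, symplecticForm_zero_right] at this
  exact this.false

theorem inv_mulVec_mulVec (hA : IsUnit B) (x : Fin n ⊕ Fin n → ℝ) :
    B⁻¹.mulVec (B.mulVec x) = x := by
  rw [Matrix.mulVec_mulVec, Matrix.nonsing_inv_mul _ ((Matrix.isUnit_iff_isUnit_det _).1 hA),
    Matrix.one_mulVec]

theorem mulVec_inv_mulVec (hA : IsUnit B) (x : Fin n ⊕ Fin n → ℝ) :
    B.mulVec (B⁻¹.mulVec x) = x := by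
  rw [Matrix.mulVec_mulVec, Matrix.mul_nonsing_inv _ ((Matrix.isUnit_iff_isUnit_det _).1 hA),
    Matrix.one_mulVec]

theorem cayley_mem (hW : W ∈ positiveSymplectic n) : cayley W ∈ negativeShiftedSp n := by
  have hU := isUnit_sub_one hW
  constructor
  · intro u v
    obtain ⟨x, rfl⟩ := Matrix.mulVec_surjective_iff_isUnit.2 hU u
    obtain ⟨y, rfl⟩ := Matrix.mulVec_surjective_iff_isUnit.2 hU v
    rw [cayley, inv_mulVec_mulVec hU, inv_mulVec_mulVec hU]
    simp only [Matrix.sub_mulVec, Matrix.one_mulVec, symplecticForm_sub_left,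
      symplecticForm_sub_right, hW.1]
    ring
  · intro u hu
    obtain ⟨x, rfl⟩ := Matrix.mulVec_surjective_iff_isUnit.2 hU u
    have hx : x ≠ 0 := by rintro rfl; simp at hu
    rw [cayley, inv_mulVec_mulVec hU, Matrix.sub_mulVec, Matrix.one_mulVec,
      symplecticForm_sub_left, symplecticForm_self, sub_zero, symplecticForm_antisymm, neg_lt_zero]
    exact hW.2 x hx

theorem cayleyInv_mem (hB : B ∈ negativeShiftedSp n) : cayleyInv B ∈ positiveSymplectic n := by
  have hU := isUnit_of_mem_negativeShiftedSp hB
  have hmul (x) : (cayleyInv B).mulVec (B.mulVec x) = B.mulVec x + x := by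
    rw [cayleyInv, Matrix.add_mulVec, Matrix.one_mulVec, inv_mulVec_mulVec hU]
  constructor
  · intro u v
    obtain ⟨x, rfl⟩ := Matrix.mulVec_surjective_iff_isUnit.2 hU u
    obtain ⟨y, rfl⟩ := Matrix.mulVec_surjective_iff_isUnit.2 hU v
    rw [hmul, hmul]
    simp only [symplecticForm_add_left, symplecticForm_add_right]
    linarith [hB.1 x y]
  · intro u hu
    obtain ⟨x, rfl⟩ := Matrix.mulVec_surjective_iff_isUnit.2 hU u
    have hx : x ≠ 0 := by rintro rfl; simp at hu
    rw [hmul, symplecticForm_add_right, symplecticForm_self, zero_add, symplecticForm_antisymm]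
    linarith [hB.2 x hx]

theorem cayleyInv_cayley (hW : W ∈ positiveSymplectic n) : cayleyInv (cayley W) = W := by
  rw [cayleyInv, cayley, Matrix.nonsing_inv_nonsing_inv _
    ((Matrix.isUnit_iff_isUnit_det _).1 (isUnit_sub_one hW)), add_sub_cancel]

theorem cayley_cayleyInv (hB : B ∈ negativeShiftedSp n) : cayley (cayleyInv B) = B := by
  rw [cayleyInv, cayley, add_sub_cancel_left, Matrix.nonsing_inv_nonsing_inv _
    ((Matrix.isUnit_iff_isUnit_det _).1 (isUnit_of_mem_negativeShiftedSp hB))]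

theorem symplecticForm_mulVec_swap (hB : B ∈ shiftedSp n) (u v : Fin n ⊕ Fin n → ℝ) :
    symplecticForm v (B.mulVec u) = symplecticForm u (B.mulVec v) + symplecticForm u v := by
  have := hB u v
  rw [symplecticForm_antisymm (B.mulVec u)] at this
  linarith

theorem eq_zero_of_symm_of_forall_self_eq_zero
    (hs : ∀ u v, symplecticForm u (D.mulVec v) = symplecticForm v (D.mulVec u))
    (h : ∀ u, symplecticForm u (D.mulVec u) = 0) : D = 0 := by
  refine matrix_eq_of_forall_symplecticForm_eq fun u v => ?_
  have := h (u + v)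
  rw [Matrix.mulVec_add, symplecticForm_add_right, symplecticForm_add_left,
    symplecticForm_add_left, h, h, hs v u] at this
  rw [Matrix.zero_mulVec, symplecticForm_zero_right]
  linarith

/-- The Cayley chart maps a tangent vector `W X` to `-B W X B`, where `B = cayley W`; its bilinear
form is that of `X`, pulled back by `B`. -/
theorem symplecticForm_cayley_velocity (hW : W ∈ positiveSymplectic n)
    (u v : Fin n ⊕ Fin n → ℝ) :
    symplecticForm u ((-(cayley W * (W * X) * cayley W)).mulVec v) =
      symplecticForm ((cayley W).mulVec u) (X.mulVec ((cayley W).mulVec v)) := by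
  have hBW : cayley W * W = cayley W + 1 := by
    have h : cayley W * (W - 1) = 1 :=
      Matrix.nonsing_inv_mul _ ((Matrix.isUnit_iff_isUnit_det _).1 (isUnit_sub_one hW))
    rw [mul_sub, mul_one] at h
    rw [← h]; abel
  rw [← mul_assoc, hBW, Matrix.neg_mulVec, ← Matrix.mulVec_mulVec, ← Matrix.mulVec_mulVec,
    Matrix.add_mulVec, Matrix.one_mulVec, symplecticForm_neg_right, symplecticForm_add_right]
  linarith [(cayley_mem hW).1 u (X.mulVec ((cayley W).mulVec v))]

/-- The inverse of the Cayley chart maps the tangent vector `D` at `B` to `W X`, where the bilinear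
form of `X` is that of `D`, pulled back by `B⁻¹`. -/
theorem symplecticForm_cayleyInv_velocity (hB : B ∈ negativeShiftedSp n)
    (u v : Fin n ⊕ Fin n → ℝ) :
    symplecticForm u (((cayleyInv B)⁻¹ * -(B⁻¹ * D * B⁻¹)).mulVec v) =
      symplecticForm (B⁻¹.mulVec u) (D.mulVec (B⁻¹.mulVec v)) := by
  have hU := isUnit_of_mem_negativeShiftedSp hB
  have hW := cayleyInv_mem hB
  obtain ⟨x, rfl⟩ := Matrix.mulVec_surjective_iff_isUnit.2 hU u
  have hmul : (cayleyInv B).mulVec (B.mulVec x) = B.mulVec x + x := by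
    rw [cayleyInv, Matrix.add_mulVec, Matrix.one_mulVec, inv_mulVec_mulVec hU]
  rw [← hW.1, ← Matrix.mulVec_mulVec, mulVec_inv_mulVec (isUnit_of_mem_positiveSymplectic hW),
    hmul, inv_mulVec_mulVec hU, Matrix.neg_mulVec, ← Matrix.mulVec_mulVec,
    ← Matrix.mulVec_mulVec, symplecticForm_neg_right, symplecticForm_add_left]
  have := hB.1 x (B⁻¹.mulVec (D.mulVec (B⁻¹.mulVec v)))
  rw [mulVec_inv_mulVec hU] at this
  linarith

end Cayley

/-! ### Differentiating inverses and coefficients of matrices -/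

section MatrixCalculus

variable {n : ℕ} {f : ℝ → Matrix (Fin n ⊕ Fin n) (Fin n ⊕ Fin n) ℝ} {s : Set ℝ} {t : ℝ}

theorem ContDiffOn.matrix_inv (hf : ContDiffOn ℝ ∞ f s) (h : ∀ t ∈ s, IsUnit (f t)) :
    ContDiffOn ℝ ∞ (fun t => (f t)⁻¹) s := by
  have : CompleteSpace (Matrix (Fin n ⊕ Fin n) (Fin n ⊕ Fin n) ℝ) :=
    FiniteDimensional.complete ℝ _
  intro t ht
  obtain ⟨x, hx⟩ := h t ht
  have := contDiffAt_ringInverse ℝ x (n := ∞)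
  rw [hx] at this
  simp only [Matrix.nonsing_inv_eq_ringInverse]
  exact this.comp_contDiffWithinAt t (hf t ht)

theorem HasDerivWithinAt.matrix_inv {f' : Matrix (Fin n ⊕ Fin n) (Fin n ⊕ Fin n) ℝ}
    (hf : HasDerivWithinAt f f' s t) (h : IsUnit (f t)) :
    HasDerivWithinAt (fun t => (f t)⁻¹) (-((f t)⁻¹ * f' * (f t)⁻¹)) s t := by
  have : CompleteSpace (Matrix (Fin n ⊕ Fin n) (Fin n ⊕ Fin n) ℝ) :=
    FiniteDimensional.complete ℝ _
  obtain ⟨x, hx⟩ := h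
  have := hasFDerivAt_ringInverse (𝕜 := ℝ) x
  rw [hx] at this
  simp only [Matrix.nonsing_inv_eq_ringInverse]
  have h2 := this.comp_hasDerivWithinAt t hf
  rw [← hx, Ring.inverse_unit]
  exact h2

theorem continuousOn_matrix_inv :
    ContinuousOn (fun A : Matrix (Fin n ⊕ Fin n) (Fin n ⊕ Fin n) ℝ => A⁻¹) {A | IsUnit A} := by
  have : CompleteSpace (Matrix (Fin n ⊕ Fin n) (Fin n ⊕ Fin n) ℝ) :=
    FiniteDimensional.complete ℝ _
  rintro A ⟨x, rfl⟩
  simp only [Matrix.nonsing_inv_eq_ringInverse]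
  exact (NormedRing.inverse_continuousAt x).continuousWithinAt

/-- The linear functional `A ↦ ω(u, A v)` on matrices. -/
noncomputable def symplecticCoeff (u v : Fin n ⊕ Fin n → ℝ) :
    Matrix (Fin n ⊕ Fin n) (Fin n ⊕ Fin n) ℝ →L[ℝ] ℝ :=
  LinearMap.toContinuousLinearMap
    { toFun := fun A => symplecticForm u (A.mulVec v)
      map_add' := fun A B => by rw [Matrix.add_mulVec, symplecticForm_add_right]
      map_smul' := fun c A => by rw [Matrix.smul_mulVec, symplecticForm_smul_right]; rfl }

end MatrixCalculus

/-! ### The causal structure in the Cayley chart -/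

section CausalStructure

variable {n : ℕ} {γ : ℝ → Matrix (Fin n ⊕ Fin n) (Fin n ⊕ Fin n) ℝ} {a b t : ℝ}
  {p q : Matrix (Fin n ⊕ Fin n) (Fin n ⊕ Fin n) ℝ}

theorem IsCausalCurve.hasDerivWithinAt_cayley
    (h : IsCausalCurve (positiveSymplectic n) (symplecticCone n) γ a b) (ht : t ∈ Icc a b) :
    ∃ X ∈ symplecticConeAtId n, ∀ u v, HasDerivWithinAt
      (fun s => symplecticForm u ((cayley (γ s)).mulVec v))
      (symplecticForm ((cayley (γ t)).mulVec u) (X.mulVec ((cayley (γ t)).mulVec v)))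
      (Icc a b) t := by
  obtain ⟨X, hX, hXt⟩ := h.velocity_mem t ht
  refine ⟨X, hX, fun u v => ?_⟩
  have hd : HasDerivWithinAt γ (γ t * X) (Icc a b) t := by
    rw [show γ t * X = derivWithin γ (Icc a b) t from hXt]
    exact ((h.smooth t ht).differentiableWithinAt (by simp)).hasDerivWithinAt
  have := ((symplecticCoeff u v).hasFDerivAt.comp_hasDerivWithinAt t
    ((hd.sub_const 1).matrix_inv (isUnit_sub_one (h.mem t ht))))
  rw [← symplecticForm_cayley_velocity (h.mem t ht)]
  exact this

theorem IsCausalCurve.monotoneOn_cayley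
    (h : IsCausalCurve (positiveSymplectic n) (symplecticCone n) γ a b)
    (u : Fin n ⊕ Fin n → ℝ) :
    MonotoneOn (fun s => symplecticForm u ((cayley (γ s)).mulVec u)) (Icc a b) := by
  choose! X hX hd using fun t ht => h.hasDerivWithinAt_cayley (t := t) ht
  refine monotoneOn_of_hasDerivWithinAt_nonneg (convex_Icc a b)
    (fun t ht => (hd t ht u u).continuousWithinAt)
    (fun t ht => (hd t (interior_subset ht) u u).mono interior_subset)
    fun t ht => (hX t (interior_subset ht)).2.2 _

theorem IsCausalCurve.ne_of_positiveSymplectic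
    (h : IsCausalCurve (positiveSymplectic n) (symplecticCone n) γ a b) : γ a ≠ γ b := by
  intro hab
  have ha : a ∈ Icc a b := left_mem_Icc.2 h.lt.le
  have hb : b ∈ Icc a b := right_mem_Icc.2 h.lt.le
  obtain ⟨X, hX, hd⟩ := h.hasDerivWithinAt_cayley ha
  refine hX.1 (eq_zero_of_symm_of_forall_self_eq_zero hX.2.1 fun w => ?_)
  have hU := isUnit_of_mem_negativeShiftedSp (cayley_mem (h.mem a ha))
  obtain ⟨u, rfl⟩ := Matrix.mulVec_surjective_iff_isUnit.2 hU w
  -- a monotone function with equal values at the end points is constant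
  have hconst (s) (hs : s ∈ Icc a b) : symplecticForm u ((cayley (γ s)).mulVec u) =
      symplecticForm u ((cayley (γ a)).mulVec u) := by
    have hm := h.monotoneOn_cayley u
    refine le_antisymm ((hm hs hb hs.2).trans_eq ?_) (hm ha hs hs.1)
    simp only [hab]
  exact ((uniqueDiffOn_Icc h.lt) a ha).eq_deriv _ (hd u u)
    ((hasDerivWithinAt_const a _ _).congr hconst rfl)

theorem CausallyJoined.cayley_le
    (h : CausallyJoined (positiveSymplectic n) (symplecticCone n) p q)
    (u : Fin n ⊕ Fin n → ℝ) :
    symplecticForm u ((cayley p).mulVec u) ≤ symplecticForm u ((cayley q).mulVec u) := by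
  obtain ⟨γ, a, b, hγ, rfl, rfl⟩ := h
  exact hγ.monotoneOn_cayley u (left_mem_Icc.2 hγ.lt.le) (right_mem_Icc.2 hγ.lt.le) hγ.lt.le

/-- Segments in the Cayley chart are causal curves. -/
theorem causallyJoined_of_cayley_le (hp : p ∈ positiveSymplectic n)
    (hq : q ∈ positiveSymplectic n) (hne : p ≠ q)
    (h : ∀ u, symplecticForm u ((cayley p).mulVec u) ≤ symplecticForm u ((cayley q).mulVec u)) :
    CausallyJoined (positiveSymplectic n) (symplecticCone n) p q := by
  set D := cayley q - cayley p with hD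
  set β : ℝ → Matrix (Fin n ⊕ Fin n) (Fin n ⊕ Fin n) ℝ := fun t => cayley p + t • D with hβ
  have hp' := cayley_mem hp
  have hq' := cayley_mem hq
  have hβmem (t) (ht : t ∈ Icc (0 : ℝ) 1) : β t ∈ negativeShiftedSp n := by
    constructor
    · intro u v
      have h1 := hp'.1 u v
      have h2 := hq'.1 u v
      simp only [hβ, hD, Matrix.add_mulVec, Matrix.smul_mulVec, Matrix.sub_mulVec,
        symplecticForm_add_left, symplecticForm_add_right, symplecticForm_smul_left,
        symplecticForm_smul_right, symplecticForm_sub_left, symplecticForm_sub_right]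
      linear_combination (1 - t) * h1 + t * h2
    · intro u hu
      have h1 := hq'.2 u hu
      have h2 := mul_nonneg (sub_nonneg.2 ht.2) (sub_nonneg.2 (h u))
      simp only [hβ, hD, Matrix.add_mulVec, Matrix.smul_mulVec, Matrix.sub_mulVec,
        symplecticForm_add_right, symplecticForm_smul_right, symplecticForm_sub_right]
      linarith
  have hβd (t) : HasDerivAt β D t := by
    have := ((hasDerivAt_id t).smul_const D).const_add (cayley p)
    rwa [one_smul] at this
  have hβs : ContDiff ℝ ∞ β := contDiff_const.add (contDiff_id.smul contDiff_const)
  have hβU (t) (ht : t ∈ Icc (0 : ℝ) 1) : IsUnit (β t) :=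
    isUnit_of_mem_negativeShiftedSp (hβmem t ht)
  refine ⟨fun t => cayleyInv (β t), 0, 1, ⟨one_pos, ?_, ?_, ?_⟩, ?_, ?_⟩
  · exact contDiffOn_const.add (hβs.contDiffOn.matrix_inv hβU)
  · exact fun t ht => cayleyInv_mem (hβmem t ht)
  · intro t ht
    have hd : HasDerivWithinAt (fun t => cayleyInv (β t)) (-((β t)⁻¹ * D * (β t)⁻¹)) (Icc 0 1) t :=
      ((hβd t).hasDerivWithinAt.matrix_inv (hβU t ht)).const_add 1
    rw [hd.derivWithin (uniqueDiffOn_Icc one_pos t ht)]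
    have hform := symplecticForm_cayleyInv_velocity (D := D) (hβmem t ht)
    refine ⟨(cayleyInv (β t))⁻¹ * -((β t)⁻¹ * D * (β t)⁻¹), ⟨?_, ?_, ?_⟩, ?_⟩
    · intro h0
      have hD0 : D = 0 := by
        refine matrix_eq_of_forall_symplecticForm_eq fun u v => ?_
        have := hform ((β t).mulVec u) ((β t).mulVec v)
        rw [h0, inv_mulVec_mulVec (hβU t ht), inv_mulVec_mulVec (hβU t ht)] at this
        rw [← this, Matrix.zero_mulVec, Matrix.zero_mulVec, symplecticForm_zero_right,
          symplecticForm_zero_right]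
      rw [hD, sub_eq_zero] at hD0
      exact hne (by rw [← cayleyInv_cayley hp, ← hD0, cayleyInv_cayley hq])
    · intro u v
      rw [hform, hform, hD]
      simp only [Matrix.sub_mulVec, symplecticForm_sub_right]
      linarith [symplecticForm_mulVec_swap hp'.1 ((β t)⁻¹.mulVec u) ((β t)⁻¹.mulVec v),
        symplecticForm_mulVec_swap hq'.1 ((β t)⁻¹.mulVec u) ((β t)⁻¹.mulVec v)]
    · intro u
      rw [hform, hD, Matrix.sub_mulVec, symplecticForm_sub_right]
      exact sub_nonneg.2 (h _)
    · exact Matrix.mul_nonsing_inv_cancel_left _ _ ((Matrix.isUnit_iff_isUnit_det _).1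
        (isUnit_of_mem_positiveSymplectic (cayleyInv_mem (hβmem t ht))))
  · simp [hβ, cayleyInv_cayley hp]
  · simp [hβ, hD, cayleyInv_cayley hq]

/-- The matrices `B` with `B + ½ ∈ 𝔰𝔭(2n)` whose quadratic form `u ↦ ω(u, B u)` lies between those
of `B₀` and `B₁`. -/
def shiftedSpInterval (B₀ B₁ : Matrix (Fin n ⊕ Fin n) (Fin n ⊕ Fin n) ℝ) :
    Set (Matrix (Fin n ⊕ Fin n) (Fin n ⊕ Fin n) ℝ) :=
  {B | B ∈ shiftedSp n ∧ ∀ u, symplecticForm u (B.mulVec u) ∈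
    Icc (symplecticForm u (B₀.mulVec u)) (symplecticForm u (B₁.mulVec u))}

theorem isClosed_shiftedSpInterval (B₀ B₁ : Matrix (Fin n ⊕ Fin n) (Fin n ⊕ Fin n) ℝ) :
    IsClosed (shiftedSpInterval B₀ B₁) := by
  have hc (u v) : Continuous fun A : Matrix (Fin n ⊕ Fin n) (Fin n ⊕ Fin n) ℝ =>
      symplecticForm u (A.mulVec v) := (symplecticCoeff u v).continuous
  refine IsClosed.and ?_ ?_
  · simp only [shiftedSp, ofPred_forall]
    refine isClosed_iInter fun u => isClosed_iInter fun v => ?_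
    simp only [symplecticForm_antisymm (Matrix.mulVec _ u) v]
    exact isClosed_eq (((hc v u).neg.add (hc u v)).add continuous_const) continuous_const
  · simp only [ofPred_forall]
    exact isClosed_iInter fun u => isClosed_Icc.preimage (hc u u)

/-- By polarization, an order interval of quadratic forms is bounded. -/
theorem isCompact_shiftedSpInterval (B₀ B₁ : Matrix (Fin n ⊕ Fin n) (Fin n ⊕ Fin n) ℝ) :
    IsCompact (shiftedSpInterval B₀ B₁) := by
  have bound (u v : Fin n ⊕ Fin n → ℝ) : ∃ c d : ℝ, ∀ B ∈ shiftedSpInterval B₀ B₁,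
      symplecticForm u (B.mulVec v) ∈ Icc c d := by
    let l (u) := symplecticForm u (B₀.mulVec u)
    let h (u) := symplecticForm u (B₁.mulVec u)
    refine ⟨(l (u + v) - h u - h v - symplecticForm u v) / 2,
      (h (u + v) - l u - l v - symplecticForm u v) / 2, fun B hB => ?_⟩
    obtain ⟨h1, h1'⟩ := hB.2 u
    obtain ⟨h2, h2'⟩ := hB.2 v
    obtain ⟨h3, h3'⟩ := hB.2 (u + v)
    have h4 := symplecticForm_mulVec_swap hB.1 u v
    have h5 : symplecticForm (u + v) (B.mulVec (u + v)) = symplecticForm u (B.mulVec u) +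
        symplecticForm v (B.mulVec v) + symplecticForm u (B.mulVec v) +
        symplecticForm v (B.mulVec u) := by
      simp only [Matrix.mulVec_add, symplecticForm_add_left, symplecticForm_add_right]; ring
    constructor <;> simp only [l, h] <;> linarith
  have entry (i j : Fin n ⊕ Fin n) : ∃ c d : ℝ, ∀ B ∈ shiftedSpInterval B₀ B₁,
      B i j ∈ Icc c d := by
    rcases i with i | i
    · obtain ⟨c, d, h⟩ := bound (Pi.single (Sum.inr i) 1) (Pi.single j 1)
      refine ⟨-d, -c, fun B hB => ?_⟩
      have := h B hB
      rw [symplecticForm_single_inr, Matrix.mulVec_single_one, Matrix.col_apply] at this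
      exact ⟨by linarith [this.2], by linarith [this.1]⟩
    · obtain ⟨c, d, h⟩ := bound (Pi.single (Sum.inl i) 1) (Pi.single j 1)
      refine ⟨c, d, fun B hB => ?_⟩
      have := h B hB
      rwa [symplecticForm_single_inl, Matrix.mulVec_single_one, Matrix.col_apply] at this
  choose c d hcd using entry
  have hbox : IsCompact {B : Matrix (Fin n ⊕ Fin n) (Fin n ⊕ Fin n) ℝ |
      ∀ i ∈ univ, B i ∈ {r : Fin n ⊕ Fin n → ℝ | ∀ j ∈ univ, r j ∈ Icc (c i j) (d i j)}} :=
    isCompact_univ_pi fun i => isCompact_univ_pi fun j => isCompact_Icc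
  exact hbox.of_isClosed_subset (isClosed_shiftedSpInterval B₀ B₁)
    fun B hB i _ j _ => hcd i j B hB

theorem mem_causalFuture_iff (hp : p ∈ positiveSymplectic n) :
    q ∈ causalFuture (positiveSymplectic n) (symplecticCone n) p ↔ q ∈ positiveSymplectic n ∧
      ∀ u, symplecticForm u ((cayley p).mulVec u) ≤ symplecticForm u ((cayley q).mulVec u) := by
  constructor
  · rintro (h | rfl)
    · refine ⟨?_, h.cayley_le⟩
      obtain ⟨γ, a, b, hγ, -, rfl⟩ := h
      exact hγ.mem b (right_mem_Icc.2 hγ.lt.le)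
    · exact ⟨hp, fun _ => le_rfl⟩
  · rintro ⟨hq, h⟩
    rcases eq_or_ne p q with rfl | hne
    · exact Or.inr rfl
    · exact Or.inl (causallyJoined_of_cayley_le hp hq hne h)

theorem mem_causalPast_iff (hq : q ∈ positiveSymplectic n) :
    p ∈ causalPast (positiveSymplectic n) (symplecticCone n) q ↔ p ∈ positiveSymplectic n ∧
      ∀ u, symplecticForm u ((cayley p).mulVec u) ≤ symplecticForm u ((cayley q).mulVec u) := by
  constructor
  · rintro (h | rfl)
    · refine ⟨?_, h.cayley_le⟩
      obtain ⟨γ, a, b, hγ, rfl, -⟩ := h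
      exact hγ.mem a (left_mem_Icc.2 hγ.lt.le)
    · exact ⟨hq, fun _ => le_rfl⟩
  · rintro ⟨hp, h⟩
    rcases eq_or_ne p q with rfl | hne
    · exact Or.inr rfl
    · exact Or.inl (causallyJoined_of_cayley_le hp hq hne h)

theorem causalDiamond_eq_image (hp : p ∈ positiveSymplectic n) (hq : q ∈ positiveSymplectic n) :
    causalFuture (positiveSymplectic n) (symplecticCone n) p ∩
      causalPast (positiveSymplectic n) (symplecticCone n) q =
    cayleyInv '' shiftedSpInterval (cayley p) (cayley q) := by
  ext W
  rw [mem_inter_iff, mem_causalFuture_iff hp, mem_causalPast_iff hq]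
  constructor
  · rintro ⟨⟨hW, h1⟩, -, h2⟩
    exact ⟨cayley W, ⟨(cayley_mem hW).1, fun u => ⟨h1 u, h2 u⟩⟩, cayleyInv_cayley hW⟩
  · rintro ⟨B, hB, rfl⟩
    have hB' : B ∈ negativeShiftedSp n :=
      ⟨hB.1, fun u hu => (hB.2 u).2.trans_lt ((cayley_mem hq).2 u hu)⟩
    rw [cayley_cayleyInv hB']
    exact ⟨⟨cayleyInv_mem hB', fun u => (hB.2 u).1⟩, cayleyInv_mem hB', fun u => (hB.2 u).2⟩

end CausalStructure

/-! ### Global hyperbolicity -/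

theorem theorem1 (n : ℕ) :
    IsGloballyHyperbolic (positivelyEllipticRegion n) (symplecticCone n) := by
  rw [positivelyEllipticRegion_eq_positiveSymplectic]
  refine ⟨fun γ a b h => h.ne_of_positiveSymplectic, fun p hp q hq => ?_⟩
  rw [causalDiamond_eq_image hp hq]
  refine (isCompact_shiftedSpInterval _ _).image_of_continuousOn ?_
  refine continuousOn_const.add (continuousOn_matrix_inv.mono fun B hB => ?_)
  exact isUnit_of_mem_negativeShiftedSp
    ⟨hB.1, fun u hu => (hB.2 u).2.trans_lt ((cayley_mem hq).2 u hu)⟩
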